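/- For non-negative integers $N,k$ put $(A;q)_k=\prod_{i=0}^{k-1}(1-Aq^i)$ and $\begin{bmatrix}N\\k\end{bmatrix}_q=\dfrac{(q^N;q^{-1})_k}{(q;q)_k}$. For integers $0\le k\le n-1$ let $$og_{k,2n}(q)=\frac{(q^{4(n-k)};q^4)_k}{(q^2;q^2)_k}\cdot\frac{1-q^{2n}}{1-q^{2(n-k)}}.$$ For $n\ge 1$ let the rational functions $h_0^{(n)}(q),\dots,h_{n-1}^{(n)}(q)\in\mathbb{Q}(q)$ be defined recursively by the $n$ equations $$og_{k,2n}(q)=\sum_{j=0}^{k}q^{(k-j)(k-j+1)}\,h_j^{(n)}(q)\begin{bmatrix}2n-1-k-j\\k-j\end{bmatrix}_{q^2},\qquad 0\le k\le n-1.$$ Then for all integers $n\ge 1$ and $0\le m\le n-1$, $h_m^{(n)}(q)$ is a polynomial in $q$ of degree $m(2n-m-1)$ whose coefficients are non-negative integers. -/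

import Mathlib

open Finset

/-- The `q`-Pochhammer symbol `(A; q)_n = ∏_{k=0}^{n-1} (1 - A q^k)`. -/
def qPoch {K : Type*} [Field K] (A q : K) (n : ℕ) : K :=
  ∏ k ∈ range n, (1 - A * q ^ k)

/-- The `q`-binomial coefficient `(q^n; q⁻¹)_k / (q; q)_k`. -/
def qBinom {K : Type*} [Field K] (n k : ℕ) (q : K) : K :=
  qPoch (q ^ n) q⁻¹ k / qPoch q q k

/-- `og_{k,2n}(q) = (q^{4(n-k)}; q^4)_k / (q^2; q^2)_k * (1 - q^{2n}) / (1 - q^{2(n-k)})`,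
used for `0 ≤ k ≤ n - 1`. -/
def ogFun {K : Type*} [Field K] (q : K) (n k : ℕ) : K :=
  qPoch (q ^ (4 * (n - k))) (q ^ 4) k / qPoch (q ^ 2) (q ^ 2) k *
    ((1 - q ^ (2 * n)) / (1 - q ^ (2 * (n - k))))

/-- The functions `h_k^{(n)}(q)`, `0 ≤ k ≤ n - 1`, defined recursively by the equations
`og_{k,2n}(q) = ∑_{j=0}^k q^{(k-j)(k-j+1)} h_j^{(n)}(q) [2n-1-k-j, k-j]_{q^2}`,
in which the term `j = k` is `h_k^{(n)}(q)` itself (see `hFun_spec` and `hFun_unique`).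
Only the values at `k ≤ n - 1` are meaningful. -/
def hFun {K : Type*} [Field K] (q : K) (n k : ℕ) : K :=
  ogFun q n k - ∑ j : Fin k, q ^ ((k - j.1) * (k - j.1 + 1)) * hFun q n j.1 *
    qBinom (2 * n - 1 - k - j.1) (k - j.1) (q ^ 2)
termination_by k
decreasing_by exact j.2

/-- The functions `h_j^{(n)}(q)` satisfy their defining equations. -/
theorem hFun_spec {K : Type*} [Field K] (q : K) (n k : ℕ) :
    ogFun q n k = ∑ j ∈ range (k + 1), q ^ ((k - j) * (k - j + 1)) * hFun q n j *
      qBinom (2 * n - 1 - k - j) (k - j) (q ^ 2) := by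
  rw [sum_range_succ, hFun.eq_1 q n k,
    Fin.sum_univ_eq_sum_range (fun j => q ^ ((k - j) * (k - j + 1)) * hFun q n j *
      qBinom (2 * n - 1 - k - j) (k - j) (q ^ 2)) k]
  simp [qBinom, qPoch]

/-- The first `n` defining equations determine `h_j^{(n)}(q)` for `0 ≤ j ≤ n - 1`. -/
theorem hFun_unique {K : Type*} [Field K] (q : K) (n : ℕ) (f : ℕ → K)
    (hf : ∀ k < n, ogFun q n k = ∑ j ∈ range (k + 1), q ^ ((k - j) * (k - j + 1)) * f j *
      qBinom (2 * n - 1 - k - j) (k - j) (q ^ 2)) :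
    ∀ k < n, f k = hFun q n k := by
  intro k
  induction k using Nat.strong_induction_on with
  | _ k ih =>
    intro hk
    have h1 := hf k hk
    rw [hFun_spec q n k, sum_range_succ, sum_range_succ,
      sum_congr rfl (fun j hj => by
        rw [← ih j (mem_range.1 hj) ((mem_range.1 hj).trans hk)])] at h1
    have h2 := add_left_cancel h1
    simpa [qBinom, qPoch] using h2.symm

/-!
Write `Q = q ^ 2`; every quantity in the recursion is a function of `Q`. The functions `h_m` have
the manifestly positive form `h_0 = g_0`, `h_m = g_m + g_{m-1}`, where
`g_i = a_i + Q ^ (n - i) * g_{i-1}`, the `a_i` vanish for odd `i`, and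
`a_{2s} = [n-1, s] + Q ^ (n - 2s) * [n-1, s-1]` with Gaussian binomials in base `Q ^ 2`
(`hFun_eq_hPoly`). All exponents are non-negative for `i < n`, so this is a polynomial with
non-negative coefficients. Its degree comes from the chain
`Q ^ (n - 1) * Q ^ (n - 2) * ⋯ * Q ^ (n - m)` inside `g_m`, no other term having larger degree
(`degree_hPoly_X_sq`).

For `Q = 1` the matrix `A` of the recursion expresses Fibonacci polynomials in monomials, the
left-hand side consists of the coefficients of `(x ^ 2 + 2) ^ n` at positive powers of `x`, and with `x = z - 1 / z` the
formula is the expansion of `(z ^ 2 + z ^ (-2)) ^ n`, first in Lucas polynomials and then in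
Fibonacci polynomials. The same two expansions exist for general `Q`.
* With the `Q`-Lucas coefficients `Z` (`lucasCoef`) one has
  `A_j + A_{j+1} = Z_j - Q ^ (n - j - 1) * Z_{j+1}` (`fibCoef_add_fibCoef_succ`). Summation by
  parts turns `∑ A_j h_j` into `∑ Z_j a_j` (`sum_mul_eq_sum_mul_of_add_succ`).
* Since `(1 + Q ^ n) * a_{2s} = (1 + Q ^ (n - 2s)) * [n, s]` (`one_add_pow_mul_evenCoef`), what is
  left is to evaluate a terminating very-well-poised `₆φ₅` series in base `Q ^ 2`
  (`sum_lucasTerm`). A telescoping identity (`lucasTerm_telescope`) shows that its sum satisfies a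
  first-order recurrence in `k`.
-/

/-! ### Gaussian binomial coefficients -/

/-- The Gaussian binomial coefficient in base `p`, defined by the `q`-Pascal rule, so that it makes
sense over any commutative semiring, in particular over `ℕ[X]`. -/
def gaussBinom {R : Type*} [CommSemiring R] (p : R) : ℕ → ℕ → R
  | _, 0 => 1
  | 0, _ + 1 => 0
  | n + 1, s + 1 => gaussBinom p n s + p ^ (s + 1) * gaussBinom p n (s + 1)

section GaussBinom

variable {R : Type*}

@[simp]
theorem gaussBinom_zero_right [CommSemiring R] (p : R) (n : ℕ) : gaussBinom p n 0 = 1 := by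
  cases n <;> rfl

theorem gaussBinom_succ_succ [CommSemiring R] (p : R) (n s : ℕ) :
    gaussBinom p (n + 1) (s + 1) = gaussBinom p n s + p ^ (s + 1) * gaussBinom p n (s + 1) :=
  rfl

theorem gaussBinom_eq_zero [CommSemiring R] (p : R) {n s : ℕ} (h : n < s) :
    gaussBinom p n s = 0 := by
  induction n generalizing s with
  | zero => cases s with
    | zero => omega
    | succ s => rfl
  | succ n ih => cases s with
    | zero => omega
    | succ s => rw [gaussBinom_succ_succ, ih (by omega), ih (by omega)]; simp

theorem map_gaussBinom {S : Type*} [CommSemiring R] [CommSemiring S] (f : R →+* S) (p : R)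
    (n s : ℕ) : f (gaussBinom p n s) = gaussBinom (f p) n s := by
  induction n generalizing s with
  | zero => cases s <;> simp [gaussBinom]
  | succ n ih => cases s <;> simp [gaussBinom_succ_succ, ih]

theorem one_sub_pow_mul_gaussBinom_succ [CommRing R] (p : R) {n s : ℕ} (h : s ≤ n) :
    (1 - p ^ (s + 1)) * gaussBinom p n (s + 1) = (1 - p ^ (n - s)) * gaussBinom p n s := by
  induction n generalizing s with
  | zero =>
    obtain rfl : s = 0 := by omega
    simp [gaussBinom]
  | succ n ih =>
    rw [gaussBinom_succ_succ]
    cases s with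
    | zero =>
      have h0 := ih (Nat.zero_le n)
      simp only [gaussBinom_zero_right, Nat.sub_zero] at h0 ⊢
      linear_combination p * h0
    | succ s =>
      rw [gaussBinom_succ_succ, Nat.add_sub_add_right]
      have h1 := ih (s := s) (by omega)
      rcases Nat.lt_or_ge n (s + 1) with hs | hs
      · obtain rfl : s = n := by omega
        simp [gaussBinom_eq_zero p (Nat.lt_succ_self s),
          gaussBinom_eq_zero p (show s < s + 1 + 1 by omega)]
      · have h2 := ih hs
        obtain ⟨d, rfl⟩ := Nat.exists_eq_add_of_le hs
        rw [show s + 1 + d - (s + 1) = d by omega] at h2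
        rw [show s + 1 + d - s = d + 1 by omega] at h1 ⊢
        linear_combination p ^ (s + 1 + 1) * h2 + h1

/-- The second `q`-Pascal rule. -/
theorem gaussBinom_succ_succ' [CommRing R] (p : R) {n s : ℕ} (h : s ≤ n) :
    gaussBinom p (n + 1) (s + 1) = p ^ (n - s) * gaussBinom p n s + gaussBinom p n (s + 1) := by
  rw [gaussBinom_succ_succ]
  linear_combination -one_sub_pow_mul_gaussBinom_succ p h

open Polynomial in
theorem natDegree_gaussBinom_X_pow_le [CommSemiring R] (d n s : ℕ) :
    (gaussBinom (X ^ d : R[X]) n s).natDegree ≤ d * (s * (n - s)) := by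
  induction n generalizing s with
  | zero => cases s <;> simp [gaussBinom]
  | succ n ih =>
    cases s with
    | zero => simp
    | succ s =>
      rw [gaussBinom_succ_succ, Nat.add_sub_add_right, ← pow_mul]
      refine natDegree_add_le_of_degree_le ((ih s).trans (by gcongr; omega)) ?_
      rcases Nat.lt_or_ge n (s + 1) with hs | hs
      · simp [gaussBinom_eq_zero _ hs]
      · refine (natDegree_mul_le_of_le (natDegree_X_pow_le _) (ih (s + 1))).trans ?_
        obtain ⟨e, rfl⟩ := Nat.exists_eq_add_of_le hs
        rw [show s + 1 + e - (s + 1) = e by omega, show s + 1 + e - s = e + 1 by omega]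
        exact le_of_eq (by ring)

end GaussBinom

/-! ### Pochhammer symbols and the quotient form of the `q`-binomial coefficient -/

section Pochhammer

variable {K : Type*} [Field K]

theorem qPoch_zero (A q : K) : qPoch A q 0 = 1 := by simp [qPoch]

theorem qPoch_succ (A q : K) (n : ℕ) : qPoch A q (n + 1) = qPoch A q n * (1 - A * q ^ n) :=
  prod_range_succ _ _

theorem qPoch_succ' (A q : K) (n : ℕ) : qPoch A q (n + 1) = (1 - A) * qPoch (A * q) q n := by
  rw [qPoch, prod_range_succ', mul_comm, qPoch]
  simp only [pow_zero, mul_one, pow_succ', mul_assoc]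

theorem qPoch_self_succ (q : K) (n : ℕ) :
    qPoch q q (n + 1) = qPoch q q n * (1 - q ^ (n + 1)) := by
  rw [qPoch_succ, pow_succ']

theorem qPoch_self_ne_zero {q : K} (hq : ∀ i, 0 < i → q ^ i ≠ 1) (n : ℕ) : qPoch q q n ≠ 0 := by
  refine prod_ne_zero_iff.2 fun i _ => sub_ne_zero.2 ?_
  rw [← pow_succ']
  exact (hq _ i.succ_pos).symm

theorem qPoch_pow_inv_mul {q : K} (h0 : q ≠ 0) (m k : ℕ) :
    qPoch (q ^ (m + k)) q⁻¹ k * qPoch q q m = qPoch q q (m + k) := by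
  induction k generalizing m with
  | zero => simp [qPoch_zero]
  | succ k ih =>
    have h1 : q ^ (m + (k + 1)) * q⁻¹ ^ k = q ^ (m + 1) := by
      rw [← add_assoc, add_right_comm, pow_add, inv_pow, mul_inv_cancel_right₀ (pow_ne_zero _ h0)]
    have h2 := ih (m + 1)
    rw [qPoch_self_succ, show m + 1 + k = m + (k + 1) by omega] at h2
    rw [qPoch_succ, h1, ← h2]
    ring

theorem qBinom_add_left {q : K} (h0 : q ≠ 0) (hq : ∀ i, 0 < i → q ^ i ≠ 1) (m k : ℕ) :
    qBinom (m + k) k q = qPoch q q (m + k) / (qPoch q q k * qPoch q q m) := by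
  have := qPoch_self_ne_zero hq m
  have := qPoch_self_ne_zero hq k
  rw [qBinom, ← qPoch_pow_inv_mul h0 m k]
  field_simp

end Pochhammer

/-! ### From Fibonacci coefficients to Lucas coefficients -/

section LucasExpansion

variable {K : Type*} [Field K]

/-- The quotient `Q ^ C(k - j, 2) / (Q; Q)_{k - j}`, extended by zero to `j > k`. With this extension
the identities below need no separate treatment of the ends of the sums. -/
def triCoef (Q : K) (k j : ℕ) : K :=
  if j ≤ k then Q ^ (k - j).choose 2 / qPoch Q Q (k - j) else 0

theorem triCoef_of_lt (Q : K) {k j : ℕ} (h : k < j) : triCoef Q k j = 0 :=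
  if_neg (not_le.2 h)

theorem triCoef_self (Q : K) (k : ℕ) : triCoef Q k k = 1 := by
  simp [triCoef, qPoch_zero]

theorem triCoef_add_left (Q : K) (j r : ℕ) :
    triCoef Q (j + r) j = Q ^ r.choose 2 / qPoch Q Q r := by
  simp [triCoef]

theorem triCoef_succ_succ (Q : K) (k j : ℕ) : triCoef Q (k + 1) (j + 1) = triCoef Q k j := by
  simp [triCoef]

theorem one_sub_pow_mul_triCoef {Q : K} (hQ : ∀ i, 0 < i → Q ^ i ≠ 1) (j r : ℕ) :
    (1 - Q ^ (r + 1)) * triCoef Q (j + (r + 1)) j =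
      Q ^ r * triCoef Q (j + (r + 1)) (j + 1) := by
  have h1 := qPoch_self_ne_zero hQ r
  have h2 : (1 : K) - Q ^ (r + 1) ≠ 0 := sub_ne_zero.2 (hQ _ r.succ_pos).symm
  rw [← add_assoc, triCoef_succ_succ, triCoef_add_left, add_assoc, triCoef_add_left,
    qPoch_self_succ, Nat.choose_succ_succ' r 1, Nat.choose_one_right,
    pow_add Q r (r.choose (1 + 1))]
  field_simp

/-- The matrix `Q ^ C(k - j + 1, 2) [2n - 1 - k - j, k - j]_Q` of the recursion, for `k < n`: a
`Q`-analogue of the coefficients of the Fibonacci polynomial of degree `2n - 1 - 2j`. -/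
def fibCoef (Q : K) (n k j : ℕ) : K :=
  Q ^ (k - j) * triCoef Q k j * qPoch Q Q (2 * n - 1 - k - j) / qPoch Q Q (2 * n - 1 - 2 * k)

/-- The quantity
`Q ^ C(k - j, 2) [2n - k - j, k - j]_Q (1 - Q ^ (n - j)) (1 + Q ^ (n - k)) / (1 - Q ^ (2n - k - j))`
for `k < n`: a `Q`-analogue of the coefficients of the Lucas polynomial of degree `2n - 2j`. -/
def lucasCoef (Q : K) (n k j : ℕ) : K :=
  triCoef Q k j * qPoch Q Q (2 * n - 1 - k - j) * (1 - Q ^ (n - j)) /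
    ((1 - Q ^ (n - k)) * qPoch Q Q (2 * n - 1 - 2 * k))

theorem fibCoef_add_fibCoef_succ {Q : K} (hQ : ∀ i, 0 < i → Q ^ i ≠ 1) {n k j : ℕ}
    (hj : j ≤ k) (hk : k < n) :
    fibCoef Q n k j + fibCoef Q n k (j + 1) =
      lucasCoef Q n k j - Q ^ (n - (j + 1)) * lucasCoef Q n k (j + 1) := by
  obtain ⟨r, rfl⟩ := Nat.exists_eq_add_of_le hj
  obtain ⟨c, rfl⟩ := Nat.exists_eq_add_of_le' hk
  have hD := qPoch_self_ne_zero hQ (2 * c + 1)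
  have hc : (1 : K) - Q ^ (c + 1) ≠ 0 := sub_ne_zero.2 (hQ _ c.succ_pos).symm
  simp only [fibCoef, lucasCoef]
  rw [show 2 * (c + (j + r).succ) - 1 - 2 * (j + r) = 2 * c + 1 by omega,
    show 2 * (c + (j + r).succ) - 1 - (j + r) - j = 2 * c + r + 1 by omega,
    show c + (j + r).succ - (j + r) = c + 1 by omega,
    show c + (j + r).succ - j = c + r + 1 by omega,
    show j + r - j = r by omega]
  cases r with
  | zero =>
    rw [triCoef_of_lt Q (show j + 0 < j + 1 by omega), add_zero, add_zero, add_zero, triCoef_self]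
    field_simp
    ring
  | succ r =>
    have hE := one_sub_pow_mul_triCoef hQ j r
    rw [show 2 * (c + (j + (r + 1)).succ) - 1 - (j + (r + 1)) - (j + 1) = 2 * c + (r + 1) by omega,
      show c + (j + (r + 1)).succ - (j + 1) = c + r + 1 by omega,
      show j + (r + 1) - (j + 1) = r by omega, ← hE, qPoch_self_succ Q (2 * c + (r + 1)),
      show Q ^ (c + r + 1) * (triCoef Q (j + (r + 1)) (j + 1) * qPoch Q Q (2 * c + (r + 1)) *
          (1 - Q ^ (c + r + 1)) / ((1 - Q ^ (c + 1)) * qPoch Q Q (2 * c + 1))) =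
        Q ^ (c + 1) * (((1 - Q ^ (r + 1)) * triCoef Q (j + (r + 1)) j) *
          qPoch Q Q (2 * c + (r + 1)) *
          (1 - Q ^ (c + r + 1)) / ((1 - Q ^ (c + 1)) * qPoch Q Q (2 * c + 1))) by rw [hE]; ring]
    field_simp
    ring

/-- Summation by parts along the two first-order recursions `h_j = g_j + g_{j-1}` and
`g_j = a_j + w_{j-1} g_{j-1}`. -/
theorem sum_mul_eq_sum_mul_of_add_succ {R : Type*} [CommRing R] {A Z w a g h : ℕ → R} {m : ℕ}
    (hA : ∀ j ≤ m, A j + A (j + 1) = Z j - w j * Z (j + 1))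
    (hg0 : g 0 = a 0) (hg : ∀ j, g (j + 1) = a (j + 1) + w j * g j)
    (hh0 : h 0 = g 0) (hh : ∀ j, h (j + 1) = g (j + 1) + g j) :
    ∑ j ∈ range (m + 1), A j * h j =
      ∑ j ∈ range (m + 1), Z j * a j - (A (m + 1) + w m * Z (m + 1)) * g m := by
  induction m with
  | zero =>
    simp only [zero_add, sum_range_one, hh0, ← hg0]
    linear_combination g 0 * hA 0 le_rfl
  | succ m ih =>
    rw [sum_range_succ, ih fun j hj => hA j (by omega), sum_range_succ _ (m + 1), hh]
    linear_combination g (m + 1) * hA (m + 1) le_rfl + Z (m + 1) * hg m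

/-! ### Evaluation of the very-well-poised sum -/

/-- The summand of the very-well-poised sum: the Gaussian binomial `[n, s]` in base `Q ^ 2` times
`Q ^ C(k - 2s, 2) [2n - k - 2s, k - 2s]_Q (1 - Q ^ (2n - 4s)) / (1 - Q ^ (2n - k - 2s))`. -/
def lucasTerm (Q : K) (n k s : ℕ) : K :=
  gaussBinom (Q ^ 2) n s * triCoef Q k (2 * s) * qPoch Q Q (2 * n - 1 - k - 2 * s) *
    (1 - Q ^ (2 * (n - 2 * s))) / qPoch Q Q (2 * n - 2 * k)

/-- The Gosper certificate for the recurrence in `k` of the sum of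
`lucasTerm Q n k s` over `s`. -/
def lucasCert (Q : K) (n k s : ℕ) : K :=
  Q ^ (k + 1 - 2 * s) * triCoef Q (k + 1) (2 * s) * gaussBinom (Q ^ 2) n s *
    (1 - Q ^ (2 * s)) * qPoch Q Q (2 * n - k - 2 * s) * (1 - Q ^ (2 * (n - k))) /
      qPoch Q Q (2 * n - 2 * k)

theorem lucasTerm_of_lt (Q : K) (n : ℕ) {k s : ℕ} (h : k < 2 * s) : lucasTerm Q n k s = 0 := by
  simp [lucasTerm, triCoef_of_lt Q h]

theorem lucasCert_of_lt (Q : K) (n : ℕ) {k s : ℕ} (h : k + 1 < 2 * s) :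
    lucasCert Q n k s = 0 := by
  simp [lucasCert, triCoef_of_lt Q h]

theorem lucasTerm_telescope {Q : K} (h0 : Q ≠ 0) (hQ : ∀ i, 0 < i → Q ^ i ≠ 1) {n k : ℕ}
    (hk : k + 1 < n) (s : ℕ) :
    (1 - Q ^ (k + 1)) * lucasTerm Q n (k + 1) s - (1 - Q ^ (2 * (n - k))) * lucasTerm Q n k s =
      lucasCert Q n k s - lucasCert Q n k (s + 1) := by
  -- The identity is generic for `2 * s ≤ k`; for `2 * s = k + 1` only two of the four terms survive.
  rcases Nat.lt_trichotomy (2 * s) (k + 1) with hs | hs | hs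
  · obtain ⟨r, rfl⟩ := Nat.exists_eq_add_of_le (Nat.lt_succ_iff.1 hs)
    obtain ⟨c, rfl⟩ := Nat.exists_eq_add_of_le' hk
    have hG := one_sub_pow_mul_gaussBinom_succ (Q ^ 2)
      (show s ≤ c + (2 * s + r + 1).succ by omega)
    have hE := one_sub_pow_mul_triCoef hQ (2 * s) r
    rw [← add_assoc, triCoef_succ_succ] at hE
    have hE2 : Q ^ (2 * s + r + 1 - 2 * (s + 1)) * triCoef Q (2 * s + r + 1) (2 * (s + 1)) =
        (1 - Q ^ r) * triCoef Q (2 * s + r) (2 * s) := by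
      rw [mul_add, mul_one, show 2 * s + 2 = (2 * s + 1) + 1 by omega, triCoef_succ_succ]
      cases r with
      | zero => simp [triCoef_of_lt Q (show 2 * s < 2 * s + 1 by omega)]
      | succ r =>
        rw [one_sub_pow_mul_triCoef hQ,
          show 2 * s + (r + 1) + 1 - (2 * s + 1 + 1) = r by omega]
    have hE' : triCoef Q (2 * s + r) (2 * s) =
        (1 - Q ^ (r + 1)) * triCoef Q (2 * s + r + 1) (2 * s) / Q ^ r := by
      rw [hE]; field_simp
    have hD := qPoch_self_ne_zero hQ (2 * c + 2)
    have hc1 : (1 : K) - Q ^ (2 * c + 3) ≠ 0 := sub_ne_zero.2 (hQ _ (by omega)).symm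
    have hc2 : (1 : K) - Q ^ (2 * c + 4) ≠ 0 := sub_ne_zero.2 (hQ _ (by omega)).symm
    have hcert : lucasCert Q (c + (2 * s + r + 1).succ) (2 * s + r) (s + 1) =
        (1 - Q ^ r) * triCoef Q (2 * s + r) (2 * s) *
        ((1 - Q ^ (2 * (c + s + r + 2))) * gaussBinom (Q ^ 2) (c + (2 * s + r + 1).succ) s) *
        qPoch Q Q (2 * c + r + 2) * (1 - Q ^ (2 * c + 4)) / qPoch Q Q (2 * c + 4) := by
      rw [lucasCert, hE2]
      rw [← pow_mul, ← pow_mul,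
        show c + (2 * s + r + 1).succ - s = c + s + r + 2 by omega] at hG
      rw [← hG,
        show 2 * (c + (2 * s + r + 1).succ) - (2 * s + r) - 2 * (s + 1) = 2 * c + r + 2 by omega,
        show 2 * (c + (2 * s + r + 1).succ - (2 * s + r)) = 2 * c + 4 by omega,
        show 2 * (c + (2 * s + r + 1).succ) - 2 * (2 * s + r) = 2 * c + 4 by omega]
      ring
    rw [hcert, hE', lucasTerm, lucasTerm, hE', lucasCert,
      show 2 * (c + (2 * s + r + 1).succ) - 1 - (2 * s + r + 1) - 2 * s = 2 * c + r + 2 by omega,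
      show 2 * (c + (2 * s + r + 1).succ) - 1 - (2 * s + r) - 2 * s = 2 * c + r + 2 + 1 by omega,
      show 2 * (c + (2 * s + r + 1).succ) - (2 * s + r) - 2 * s = 2 * c + r + 2 + 1 + 1 by omega,
      show 2 * (c + (2 * s + r + 1).succ - 2 * s) = 2 * c + 2 * r + 4 by omega,
      show 2 * (c + (2 * s + r + 1).succ) - 2 * (2 * s + r + 1) = 2 * c + 2 by omega,
      show 2 * (c + (2 * s + r + 1).succ) - 2 * (2 * s + r) = 2 * c + 2 + 1 + 1 by omega,
      show 2 * (c + (2 * s + r + 1).succ - (2 * s + r)) = 2 * c + 4 by omega,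
      show 2 * s + r + 1 - 2 * s = r + 1 by omega,
      show 2 * c + 4 = 2 * c + 2 + 1 + 1 by omega]
    simp only [qPoch_self_succ]
    generalize triCoef Q (2 * s + r + 1) (2 * s) = E
    generalize gaussBinom (Q ^ 2) _ s = B
    generalize qPoch Q Q (2 * c + r + 2) = P
    field_simp
    ring
  · have hc := qPoch_self_ne_zero hQ (2 * n - 2 * (k + 1))
    obtain ⟨c, rfl⟩ := Nat.exists_eq_add_of_le' hk
    have hc1 : (1 : K) - Q ^ (2 * c + 3) ≠ 0 := sub_ne_zero.2 (hQ _ (by omega)).symm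
    have hc2 : (1 : K) - Q ^ (2 * c + 4) ≠ 0 := sub_ne_zero.2 (hQ _ (by omega)).symm
    rw [lucasTerm_of_lt Q _ (show k < 2 * s by omega), lucasCert_of_lt Q _
      (show k + 1 < 2 * (s + 1) by omega), lucasTerm, lucasCert, hs, triCoef_self]
    rw [show 2 * (c + (k + 1).succ) - 1 - (k + 1) - (k + 1) = 2 * c + 1 by omega,
      show 2 * (c + (k + 1).succ) - k - (k + 1) = 2 * c + 1 + 1 + 1 by omega,
      show 2 * (c + (k + 1).succ - (k + 1)) = 2 * c + 2 by omega,
      show 2 * (c + (k + 1).succ) - 2 * k = 2 * c + 1 + 1 + 1 + 1 by omega,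
      show 2 * (c + (k + 1).succ - k) = 2 * c + 1 + 1 + 1 + 1 by omega, Nat.sub_self]
    rw [show 2 * (c + (k + 1).succ) - 2 * (k + 1) = 2 * c + 1 + 1 by omega] at hc ⊢
    simp only [qPoch_self_succ] at hc ⊢
    have h4 := left_ne_zero_of_mul hc
    have h5 := right_ne_zero_of_mul hc
    field_simp
    ring
  · rw [lucasTerm_of_lt Q _ hs, lucasTerm_of_lt Q _ (by omega), lucasCert_of_lt Q _ hs,
      lucasCert_of_lt Q _ (by omega)]
    simp

theorem sum_lucasTerm_of_le (Q : K) (n : ℕ) {k m : ℕ} (h : k < m) :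
    ∑ s ∈ range m, lucasTerm Q n k s = ∑ s ∈ range (k + 1), lucasTerm Q n k s := by
  refine (sum_subset (range_mono h) fun s _ hs => lucasTerm_of_lt Q n ?_).symm
  rw [mem_range] at hs
  omega

/-- The `Q`-analogue of the expansion of `(x ^ 2 + 2) ^ n` in Lucas polynomials. -/
theorem sum_lucasTerm {Q : K} (h0 : Q ≠ 0) (hQ : ∀ i, 0 < i → Q ^ i ≠ 1) {n k : ℕ} (hk : k < n) :
    ∑ s ∈ range (k + 1), lucasTerm Q n k s =
      qPoch (Q ^ (2 * (n - k + 1))) (Q ^ 2) k / qPoch Q Q k := by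
  induction k with
  | zero =>
    obtain ⟨c, rfl⟩ := Nat.exists_eq_add_of_le' hk
    have h1 := qPoch_self_ne_zero hQ (2 * c + 1)
    have h2 : (1 : K) - Q ^ (2 * c + 1 + 1) ≠ 0 := sub_ne_zero.2 (hQ _ (by omega)).symm
    simp only [zero_add, sum_range_one, lucasTerm, mul_zero, Nat.sub_zero, triCoef_self,
      gaussBinom_zero_right, qPoch_zero]
    rw [show 2 * (c + Nat.succ 0) = 2 * c + 1 + 1 by omega, Nat.add_sub_cancel,
      qPoch_self_succ Q (2 * c + 1)]
    field_simp
  | succ k ih =>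
    have ih := ih (by omega)
    have h1 := qPoch_self_ne_zero hQ k
    have h2 : (1 : K) - Q ^ (k + 1) ≠ 0 := sub_ne_zero.2 (hQ _ k.succ_pos).symm
    have htel : (1 - Q ^ (k + 1)) * ∑ s ∈ range (k + 1 + 1), lucasTerm Q n (k + 1) s -
        (1 - Q ^ (2 * (n - k))) * ∑ s ∈ range (k + 1 + 1), lucasTerm Q n k s = 0 := by
      rw [mul_sum, mul_sum, ← sum_sub_distrib,
        sum_congr rfl fun s _ => lucasTerm_telescope h0 hQ hk s, sum_range_sub',
        lucasCert_of_lt Q n (show k + 1 < 2 * (k + 1 + 1) by omega)]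
      simp [lucasCert]
    rw [sum_lucasTerm_of_le Q n (show k < k + 1 + 1 by omega), ih] at htel
    rw [show n - (k + 1) + 1 = n - k by omega, qPoch_succ', ← pow_add,
      show 2 * (n - k) + 2 = 2 * (n - k + 1) by ring, qPoch_self_succ]
    field_simp
    field_simp at htel
    linear_combination htel

end LucasExpansion

/-! ### The positive formula and its degree -/

section PositiveFormula

variable {R : Type*} [CommSemiring R]

/-- The numbers `a_i`: zero for odd `i`, and `[n-1, s] + Q ^ (n - 2s) [n-1, s-1]` in base `Q ^ 2` for
`i = 2s`. The second term is absent for `s = 0`, where `i / 2 - 1` would be truncated. -/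
def evenCoef (Q : R) (n i : ℕ) : R :=
  if Even i then
    gaussBinom (Q ^ 2) (n - 1) (i / 2) +
      if i = 0 then 0 else Q ^ (n - i) * gaussBinom (Q ^ 2) (n - 1) (i / 2 - 1)
  else 0

/-- The numbers `g_i = a_i + Q ^ (n - i) g_{i-1}`, meaningful for `i < n`. -/
def partialCoef (Q : R) (n : ℕ) : ℕ → R
  | 0 => evenCoef Q n 0
  | i + 1 => evenCoef Q n (i + 1) + Q ^ (n - (i + 1)) * partialCoef Q n i

/-- The closed form `h_m = g_m + g_{m-1}` of the solution of the recursion, meaningful for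
`m < n`. -/
def hPoly (Q : R) (n : ℕ) : ℕ → R
  | 0 => partialCoef Q n 0
  | i + 1 => partialCoef Q n (i + 1) + partialCoef Q n i

theorem map_hPoly {S : Type*} [CommSemiring S] (f : R →+* S) (Q : R) (n m : ℕ) :
    f (hPoly Q n m) = hPoly (f Q) n m := by
  have ha (i : ℕ) : f (evenCoef Q n i) = evenCoef (f Q) n i := by
    simp only [evenCoef, apply_ite f, map_add, map_mul, map_pow, map_zero, map_gaussBinom]
  have hg (i : ℕ) : f (partialCoef Q n i) = partialCoef (f Q) n i := by
    induction i with
    | zero => exact ha 0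
    | succ i ih => simp only [partialCoef, map_add, map_mul, map_pow, ha, ih]
  cases m <;> simp only [hPoly, map_add, hg]

end PositiveFormula

section Degree

open Polynomial

theorem natDegree_evenCoef_X_sq_le {n i : ℕ} (hi : i < n) :
    (evenCoef (X ^ 2 : ℕ[X]) n i).natDegree ≤ i * (2 * n - i - 1) := by
  rw [evenCoef]
  split_ifs with h1 h2
  · subst h2
    simp
  · obtain ⟨s, rfl⟩ := h1
    obtain ⟨c, rfl⟩ := Nat.exists_eq_add_of_le' hi
    obtain ⟨s, rfl⟩ := Nat.exists_eq_succ_of_ne_zero (show s ≠ 0 by omega)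
    rw [← pow_mul, ← pow_mul]
    refine natDegree_add_le_of_degree_le ((natDegree_gaussBinom_X_pow_le _ _ _).trans ?_)
      ((natDegree_mul_le_of_le (natDegree_X_pow_le _)
        (natDegree_gaussBinom_X_pow_le _ _ _)).trans ?_)
    · rw [show (s.succ + s.succ) / 2 = s + 1 by omega,
        show c + (s.succ + s.succ).succ - 1 - (s + 1) = c + s + 1 by omega,
        show 2 * (c + (s.succ + s.succ).succ) - (s.succ + s.succ) - 1 = 2 * c + 2 * s + 3 by omega]
      simp only [Nat.succ_eq_add_one]
      nlinarith
    · rw [show (s.succ + s.succ) / 2 - 1 = s by omega,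
        show c + (s.succ + s.succ).succ - 1 - s = c + s + 2 by omega,
        show c + (s.succ + s.succ).succ - (s.succ + s.succ) = c + 1 by omega,
        show 2 * (c + (s.succ + s.succ).succ) - (s.succ + s.succ) - 1 = 2 * c + 2 * s + 3 by omega]
      simp only [Nat.succ_eq_add_one]
      nlinarith
  · simp

/-- The summand `Q ^ (n - i) g_{i-1}` of `g_i` carries the top degree, and over `ℕ` its leading
coefficient cannot cancel. -/
theorem natDegree_partialCoef_X_sq_le_and_coeff_ne_zero {n i : ℕ} (hi : i < n) :
    (partialCoef (X ^ 2 : ℕ[X]) n i).natDegree ≤ i * (2 * n - i - 1) ∧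
      (partialCoef (X ^ 2 : ℕ[X]) n i).coeff (i * (2 * n - i - 1)) ≠ 0 := by
  induction i with
  | zero => simp [partialCoef, evenCoef]
  | succ i ih =>
    obtain ⟨h1, h2⟩ := ih (by omega)
    have h3 : (i + 1) * (2 * n - (i + 1) - 1) = i * (2 * n - i - 1) + 2 * (n - (i + 1)) := by
      obtain ⟨c, rfl⟩ := Nat.exists_eq_add_of_le' hi
      rw [show 2 * (c + (i + 1).succ) - (i + 1) - 1 = 2 * c + i + 2 by omega,
        show 2 * (c + (i + 1).succ) - i - 1 = 2 * c + i + 3 by omega,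
        show c + (i + 1).succ - (i + 1) = c + 1 by omega]
      ring
    rw [partialCoef]
    constructor
    · refine natDegree_add_le_of_degree_le (natDegree_evenCoef_X_sq_le hi) ?_
      rw [← pow_mul, h3, add_comm (i * _)]
      exact natDegree_mul_le_of_le (natDegree_X_pow_le _) h1
    · rw [coeff_add, ← pow_mul, h3, coeff_X_pow_mul]
      omega

theorem degree_hPoly_X_sq {n m : ℕ} (hm : m < n) :
    (hPoly (X ^ 2 : ℕ[X]) n m).degree = ((m * (2 * n - m - 1) : ℕ) : WithBot ℕ) := by
  obtain ⟨h1, h2⟩ := natDegree_partialCoef_X_sq_le_and_coeff_ne_zero hm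
  cases m with
  | zero => exact degree_eq_of_le_of_coeff_ne_zero (natDegree_le_iff_degree_le.1 h1) h2
  | succ m =>
    refine degree_eq_of_le_of_coeff_ne_zero (natDegree_le_iff_degree_le.1 ?_) ?_
    · refine natDegree_add_le_of_degree_le h1
        ((natDegree_partialCoef_X_sq_le_and_coeff_ne_zero (by omega)).1.trans ?_)
      obtain ⟨c, rfl⟩ := Nat.exists_eq_add_of_le' hm
      rw [show 2 * (c + (m + 1).succ) - (m + 1) - 1 = 2 * c + m + 2 by omega,
        show 2 * (c + (m + 1).succ) - m - 1 = 2 * c + m + 3 by omega]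
      nlinarith
    · rw [hPoly, coeff_add]
      omega

end Degree

/-! ### Solution of the recursion -/

section Solution

variable {K : Type*} [Field K]

theorem one_add_pow_mul_evenCoef (Q : K) {n s : ℕ} (hn : 1 ≤ n) (hs : 2 * s ≤ n) :
    (1 + Q ^ n) * evenCoef Q n (2 * s) =
      (1 + Q ^ (n - 2 * s)) * gaussBinom (Q ^ 2) n s := by
  rw [evenCoef, if_pos (even_two_mul s), Nat.mul_div_cancel_left s two_pos]
  cases s with
  | zero => simp
  | succ s =>
    obtain ⟨c, rfl⟩ := Nat.exists_eq_add_of_le' hs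
    have h1 := gaussBinom_succ_succ (Q ^ 2) (c + 2 * s + 1) s
    have h2 := gaussBinom_succ_succ' (Q ^ 2) (show s ≤ c + 2 * s + 1 by omega)
    rw [show c + 2 * s + 1 - s = c + s + 1 by omega] at h2
    rw [if_neg (by omega), show c + 2 * (s + 1) - 1 = c + 2 * s + 1 by omega,
      show c + 2 * (s + 1) = c + 2 * s + 1 + 1 by omega,
      show c + 2 * s + 1 + 1 - 2 * (s + 1) = c by omega, Nat.add_sub_cancel]
    linear_combination -h2 - Q ^ c * h1

theorem sum_range_two_mul_of_odd_eq_zero {M : Type*} [AddCommMonoid M] (f : ℕ → M)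
    (hf : ∀ s, f (2 * s + 1) = 0) (m : ℕ) :
    ∑ j ∈ range (2 * m), f j = ∑ s ∈ range m, f (2 * s) := by
  induction m with
  | zero => simp
  | succ m ih => rw [mul_add, mul_one, sum_range_succ, sum_range_succ, ih, hf, add_zero,
      sum_range_succ]

/-- The right-hand side is `og_{k,2n}` written in terms of `Q = q ^ 2`. -/
theorem sum_lucasCoef_mul_evenCoef {Q : K} (h0 : Q ≠ 0) (hQ : ∀ i, 0 < i → Q ^ i ≠ 1) {n k : ℕ}
    (hk : k < n) :
    ∑ j ∈ range (k + 1), lucasCoef Q n k j * evenCoef Q n j =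
      qPoch (Q ^ (2 * (n - k))) (Q ^ 2) k / qPoch Q Q k * ((1 - Q ^ n) / (1 - Q ^ (n - k))) := by
  -- `1 + Q ^ n = 0` would give `Q ^ (2 * n) = 1`.
  have hn : (1 : K) + Q ^ n ≠ 0 := fun h => hQ (n * 2) (by omega) <| by
    rw [pow_mul]
    linear_combination (Q ^ n - 1) * h
  have hn' : (1 : K) - Q ^ n ≠ 0 := sub_ne_zero.2 (hQ _ (by omega)).symm
  have hc : (1 : K) - Q ^ (n - k) ≠ 0 := sub_ne_zero.2 (hQ _ (by omega)).symm
  have hc' : (1 : K) - Q ^ (2 * (n - k)) ≠ 0 := sub_ne_zero.2 (hQ _ (by omega)).symm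
  have hkk := qPoch_self_ne_zero hQ k
  have hterm (s : ℕ) : (1 + Q ^ n) * (lucasCoef Q n k (2 * s) * evenCoef Q n (2 * s)) =
      (1 + Q ^ (n - k)) * lucasTerm Q n k s := by
    rcases Nat.lt_or_ge k (2 * s) with hs | hs
    · simp [lucasTerm_of_lt Q n hs, lucasCoef, triCoef_of_lt Q hs]
    · have ha := one_add_pow_mul_evenCoef Q (show 1 ≤ n by omega) (show 2 * s ≤ n by omega)
      have hD := qPoch_self_ne_zero hQ (2 * n - 1 - 2 * k)
      rw [mul_left_comm, ha, lucasCoef, lucasTerm,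
        show 2 * n - 2 * k = 2 * n - 1 - 2 * k + 1 by omega, qPoch_self_succ,
        show 2 * n - 1 - 2 * k + 1 = 2 * (n - k) by omega]
      have h2 (m : ℕ) : (1 : K) - Q ^ (2 * m) = (1 - Q ^ m) * (1 + Q ^ m) := by ring
      rw [h2] at hc' ⊢
      rw [h2]
      have := right_ne_zero_of_mul hc'
      field_simp
  have hsum : ∑ j ∈ range (k + 1), lucasCoef Q n k j * evenCoef Q n j =
      ∑ s ∈ range (k + 1), lucasCoef Q n k (2 * s) * evenCoef Q n (2 * s) := by
    rw [← sum_range_two_mul_of_odd_eq_zero (fun j => lucasCoef Q n k j * evenCoef Q n j)]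
    · refine sum_subset (range_mono (by omega)) fun j _ hj => ?_
      rw [mem_range] at hj
      simp [lucasCoef, triCoef_of_lt Q (show k < j by omega)]
    · intro s
      simp [evenCoef]
  -- Splitting the product `(Q ^ (2 * (n - k)); Q ^ 2)_{k + 1}` at either end compares the shifted
  -- Pochhammer symbol of `sum_lucasTerm` with the one required here.
  have hP := qPoch_succ (Q ^ (2 * (n - k))) (Q ^ 2) k
  rw [qPoch_succ', ← pow_add, ← pow_mul, ← pow_add, show 2 * (n - k) + 2 * k = 2 * n by omega,
    show 2 * (n - k) + 2 = 2 * (n - k + 1) by ring] at hP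
  refine mul_left_cancel₀ hn ?_
  rw [hsum, mul_sum, sum_congr rfl fun s _ => hterm s, ← mul_sum, sum_lucasTerm h0 hQ hk]
  field_simp
  linear_combination hP

/-- The positive formula solves the recursion at every `q` that is neither zero nor a root of
unity. -/
theorem hFun_eq_hPoly {q : K} (h0 : q ≠ 0) (hq : ∀ i, 0 < i → q ^ i ≠ 1) {n m : ℕ} (hm : m < n) :
    hFun q n m = hPoly (q ^ 2) n m := by
  have hQ0 : q ^ 2 ≠ 0 := pow_ne_zero 2 h0
  have hQ (i : ℕ) (hi : 0 < i) : (q ^ 2) ^ i ≠ 1 := by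
    rw [← pow_mul]
    exact hq _ (by omega)
  refine (hFun_unique q n (hPoly (q ^ 2) n) (fun k hk => ?_) m hm).symm
  have hA : ∀ j ∈ range (k + 1), q ^ ((k - j) * (k - j + 1)) * hPoly (q ^ 2) n j *
      qBinom (2 * n - 1 - k - j) (k - j) (q ^ 2) =
      fibCoef (q ^ 2) n k j * hPoly (q ^ 2) n j := by
    intro j hj
    rw [mem_range] at hj
    have h2 : q ^ ((k - j) * (k - j + 1)) = (q ^ 2) ^ (k - j) * (q ^ 2) ^ (k - j).choose 2 := by
      rw [← pow_add, ← pow_mul]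
      congr 1
      have := Nat.choose_succ_succ' (k - j) 1
      rw [Nat.choose_one_right] at this
      have he := (Nat.even_mul_pred_self (k - j + 1)).two_dvd
      rw [Nat.add_sub_cancel] at he
      rw [← this, Nat.choose_two_right, Nat.add_sub_cancel, mul_comm (k - j),
        Nat.mul_div_cancel' he]
    rw [h2, show 2 * n - 1 - k - j = 2 * n - 1 - 2 * k + (k - j) by omega,
      qBinom_add_left hQ0 hQ, fibCoef, triCoef, if_pos (by omega),
      show 2 * n - 1 - k - j = 2 * n - 1 - 2 * k + (k - j) by omega]
    have h3 := qPoch_self_ne_zero hQ (k - j)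
    have h4 := qPoch_self_ne_zero hQ (2 * n - 1 - 2 * k)
    field_simp
  rw [sum_congr rfl hA, sum_mul_eq_sum_mul_of_add_succ (A := fibCoef (q ^ 2) n k)
    (Z := lucasCoef (q ^ 2) n k)
    (w := fun j => (q ^ 2) ^ (n - (j + 1))) (a := evenCoef (q ^ 2) n) (g := partialCoef (q ^ 2) n)
    (h := hPoly (q ^ 2) n) (fun j hj => fibCoef_add_fibCoef_succ hQ hj hk)
    rfl (fun _ => rfl) rfl (fun _ => rfl),
    sum_lucasCoef_mul_evenCoef hQ0 hQ hk]
  simp [ogFun, fibCoef, lucasCoef, triCoef_of_lt _ (Nat.lt_succ_self k), ← pow_mul, ← mul_assoc]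

end Solution

theorem corollaryA6 (n m : ℕ) (hn : 1 ≤ n) (hm : m ≤ n - 1) :
    ∃ p : Polynomial ℕ,
      hFun (RatFunc.X : RatFunc ℚ) n m =
        algebraMap (Polynomial ℚ) (RatFunc ℚ) (p.map (Nat.castRingHom ℚ)) ∧
      p.degree = ((m * (2 * n - m - 1) : ℕ) : WithBot ℕ) := by
  have hmn : m < n := by omega
  refine ⟨hPoly (Polynomial.X ^ 2) n m, ?_, degree_hPoly_X_sq hmn⟩
  rw [hFun_eq_hPoly RatFunc.X_ne_zero (fun i hi h => ?_) hmn, ← Polynomial.coe_mapRingHom,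
    map_hPoly, map_hPoly]
  · simp
  · rw [← RatFunc.algebraMap_X, ← map_pow, ← map_one (algebraMap (Polynomial ℚ) (RatFunc ℚ))] at h
    have h1 := congrArg Polynomial.natDegree (RatFunc.algebraMap_injective ℚ h)
    simp at h1
    omega
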